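/- Let $A$ be a nonempty finite set of nonnegative integers, and put $A(x)=\sum_{a\in A}x^a$. We say that $A$ tiles the integers if there is a set $C\subseteq\mathbb Z$ such that every integer can be written uniquely as $a+c$ with $a\in A$ and $c\in C$. Let $\Phi_s(x)$ denote the $s$-th cyclotomic polynomial, and let $S_A$ be the set of prime powers $s>1$ such that $\Phi_s(x)$ divides $A(x)$ in $\mathbb Z[x]$. Consider the conditions (T1) $A(1)=\prod_{s\in S_A}\Phi_s(1)$; (T2) if $m\ge 1$ and $s_1,\dots,s_m\in S_A$ are powers of distinct primes, then $\Phi_{s_1\cdots s_m}(x)$ divides $A(x)$. If the cardinality $\#A$ has at most two distinct prime factors, then $A$ tiles the integers if and only if $A(x)$ satisfies both (T1) and (T2). (This includes the case, settled by Newman, in which $\#A$ is a prime power.) -/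

import Mathlib

namespace CovenMeyerowitz

open Polynomial

/-- The finite set `A` of nonnegative integers tiles the integers: for some set `C` of integers,
every integer is uniquely `a + c` with `a ∈ A` and `c ∈ C`. -/
def TilesIntegers (A : Finset ℕ) : Prop :=
  ∃ C : Set ℤ, ∀ n : ℤ, ∃! x : ℤ × ℤ,
    x.1 ∈ (fun a : ℕ => (a : ℤ)) '' (A : Set ℕ) ∧ x.2 ∈ C ∧ x.1 + x.2 = n

/-- The polynomial `A(x) = ∑_{a ∈ A} x ^ a`. -/
noncomputable def maskPoly (A : Finset ℕ) : ℤ[X] := ∑ a ∈ A, X ^ a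

/-- The set `S_A` of prime powers `s > 1` such that `Φ_s(x)` divides `A(x)`. -/
def primePowerIndices (A : Finset ℕ) : Set ℕ :=
  {s | IsPrimePow s ∧ cyclotomic s ℤ ∣ maskPoly A}

theorem eval_one_maskPoly (A : Finset ℕ) : (maskPoly A).eval 1 = (A.card : ℤ) := by
  simp [maskPoly, eval_finsetSum]

/-- For nonempty `A` the set `S_A` is finite, so that the product in `T1` is a finite product. -/
theorem finite_primePowerIndices {A : Finset ℕ} (hA : A.Nonempty) :
    (primePowerIndices A).Finite := by
  have h0 : maskPoly A ≠ 0 := by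
    intro h
    have h1 := eval_one_maskPoly A
    rw [h, eval_zero] at h1
    have h2 := hA.card_pos
    omega
  refine (Set.finite_Iic (2 * (maskPoly A).natDegree)).subset ?_
  rintro s ⟨hs, hd⟩
  have h1 := natDegree_le_of_dvd hd h0
  rw [natDegree_cyclotomic] at h1
  obtain ⟨p, k, hp, hk, rfl⟩ := (isPrimePow_nat_iff s).1 hs
  obtain ⟨j, rfl⟩ : ∃ j, k = j + 1 := ⟨k - 1, by omega⟩
  rw [Nat.totient_prime_pow_succ hp] at h1
  have h2 := hp.two_le
  have h3 : p ≤ 2 * (p - 1) := by omega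
  have h4 : p ^ j * p ≤ p ^ j * (2 * (p - 1)) := Nat.mul_le_mul_left _ h3
  simp only [Set.mem_Iic, pow_succ]
  nlinarith

/-- Condition (T1): `A(1) = ∏_{s ∈ S_A} Φ_s(1)`. -/
def T1 (A : Finset ℕ) : Prop :=
  (maskPoly A).eval 1 = ∏ᶠ s ∈ primePowerIndices A, (cyclotomic s ℤ).eval 1

/-- Condition (T2): if `s_1, …, s_m ∈ S_A` (`m ≥ 1`) are powers of distinct primes, then
`Φ_{s_1 ⋯ s_m}(x)` divides `A(x)`. Here `P` is the set of the `m` primes, and `p ^ e p` for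
`p ∈ P` are the prime powers. -/
def T2 (A : Finset ℕ) : Prop :=
  ∀ (P : Finset ℕ) (e : ℕ → ℕ), P.Nonempty → (∀ p ∈ P, p.Prime) →
    (∀ p ∈ P, p ^ e p ∈ primePowerIndices A) →
      cyclotomic (∏ p ∈ P, p ^ e p) ℤ ∣ maskPoly A

end CovenMeyerowitz

namespace CovenMeyerowitz

open Polynomial

/-! Sufficiency: (T1) and (T2) give an explicit complement modulo N = ∏_{s ∈ S_A} s. It is the
product of Φ_s(x^t) over the prime powers s ∣ N outside S_A, with t the part of N prime to s. Its
coefficients may be negative nowhere, (T2) makes its product with A(x) divisible by 1 + x + … +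
x^(N-1), and (T1) makes the value at 1 equal to N (`exists_geom_sum_dvd_mul`). No restriction on #A
is needed here.

Necessity: a tiling is periodic (`exists_period`), hence comes from a factorization A ⊕ B of ℤ/n.
Each Φ_s with 1 ≠ s ∣ n divides A(x) or B(x), and evaluation at 1 leaves no slack: (T1) holds, and
each prime power dividing n belongs to exactly one of A, B (`TilesMod.vanishesAt_iff`). A may be
multiplied by any positive integer prime to #A (`TilesMod.image_mul`). This removes from n the
primes not dividing #A and, when only p and q remain, forces A or B into one class modulo p or q
(`TilesMod.exists_modEq`). Dividing by that prime yields tilings of smaller period, and (T2) follows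
by induction (`TilesMod.vanishesAtProducts`). -/

/-- The exponential sum `∑_{a ∈ A} z ^ a`. -/
noncomputable def charSum (A : Finset ℤ) (z : ℂ) : ℂ := ∑ a ∈ A, z ^ a

/-- The exponential sum of `A` vanishes at all primitive `s`-th roots of unity. -/
def VanishesAt (A : Finset ℤ) (s : ℕ) : Prop :=
  ∀ z : ℂ, IsPrimitiveRoot z s → charSum A z = 0

/-- The sums `a + b` with `a ∈ A`, `b ∈ B` form a complete residue system modulo `n`. -/
def TilesMod (n : ℕ) (A B : Finset ℤ) : Prop :=
  A.card * B.card = n ∧ ∀ x : ℤ, ∃ a ∈ A, ∃ b ∈ B, a + b ≡ x [ZMOD n]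

/-! ### Vanishing at roots of unity and cyclotomic divisibility -/

theorem cyclotomic_dvd_iff_aeval_eq_zero {s : ℕ} (hs : 0 < s) {z : ℂ} (hz : IsPrimitiveRoot z s)
    (f : ℤ[X]) : cyclotomic s ℤ ∣ f ↔ aeval z f = 0 := by
  rw [cyclotomic_eq_minpoly hz hs]
  exact (minpoly.isIntegrallyClosed_dvd_iff (hz.isIntegral hs) f).symm

/-- Translating by a large k makes all exponents nonnegative; this changes neither the zeros at
roots of unity nor the value at 1. -/
theorem exists_polynomial_charSum (A : Finset ℤ) :
    ∃ (f : ℤ[X]) (k : ℕ), f.eval 1 = A.card ∧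
      ∀ z : ℂ, z ≠ 0 → aeval z f = z ^ k * charSum A z := by
  refine ⟨∑ a ∈ A, X ^ (a + (∑ b ∈ A, b.natAbs : ℕ)).toNat, ∑ b ∈ A, b.natAbs, ?_, ?_⟩
  · simp [eval_finsetSum]
  · intro z hz
    rw [map_sum, charSum, Finset.mul_sum]
    refine Finset.sum_congr rfl fun a ha => ?_
    have h1 : a.natAbs ≤ ∑ b ∈ A, b.natAbs :=
      Finset.single_le_sum (f := fun b : ℤ => b.natAbs) (fun _ _ => Nat.zero_le _) ha
    rw [map_pow, aeval_X, ← zpow_natCast, ← zpow_natCast, ← zpow_add₀ hz]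
    congr 1
    omega

theorem vanishesAt_iff_cyclotomic_dvd {A : Finset ℤ} {f : ℤ[X]} {k : ℕ}
    (hf : ∀ z : ℂ, z ≠ 0 → aeval z f = z ^ k * charSum A z) {s : ℕ} (hs : 0 < s) :
    VanishesAt A s ↔ cyclotomic s ℤ ∣ f := by
  constructor
  · intro h
    have hz := Complex.isPrimitiveRoot_exp s hs.ne'
    rw [cyclotomic_dvd_iff_aeval_eq_zero hs hz, hf _ (hz.ne_zero hs.ne'), h _ hz, mul_zero]
  · intro h z hz
    rw [cyclotomic_dvd_iff_aeval_eq_zero hs hz, hf _ (hz.ne_zero hs.ne')] at h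
    exact (mul_eq_zero.1 h).resolve_left (pow_ne_zero _ (hz.ne_zero hs.ne'))

/-- All primitive `s`-th roots are conjugate, since Φ_s is irreducible over ℚ. -/
theorem vanishesAt_of_charSum_eq_zero {A : Finset ℤ} {s : ℕ} (hs : 0 < s) {z : ℂ}
    (hz : IsPrimitiveRoot z s) (h : charSum A z = 0) : VanishesAt A s := by
  obtain ⟨f, k, -, hf⟩ := exists_polynomial_charSum A
  rw [vanishesAt_iff_cyclotomic_dvd hf hs, cyclotomic_dvd_iff_aeval_eq_zero hs hz,
    hf _ (hz.ne_zero hs.ne'), h, mul_zero]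

theorem charSum_one (A : Finset ℤ) : charSum A 1 = A.card := by
  simp [charSum]

theorem prod_cyclotomic_dvd {S : Finset ℕ} {f : ℤ[X]} (hS : ∀ s ∈ S, 0 < s)
    (h : ∀ s ∈ S, cyclotomic s ℤ ∣ f) : ∏ s ∈ S, cyclotomic s ℤ ∣ f := by
  refine Finset.prod_dvd_of_isRelPrime ?_ h
  intro s hs t ht hst
  have hi := cyclotomic.irreducible (hS s hs)
  refine (hi.isRelPrime_iff_not_dvd).2 fun hd => hst (cyclotomic_injective (R := ℤ) ?_)
  exact eq_of_monic_of_associated (cyclotomic.monic _ _) (cyclotomic.monic _ _)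
    (hi.associated_of_dvd (cyclotomic.irreducible (hS t ht)) hd)

theorem eval_one_cyclotomic_of_isPrimePow {s : ℕ} (hs : IsPrimePow s) :
    (cyclotomic s ℤ).eval 1 = s.minFac := by
  obtain ⟨p, k, hp, hk, rfl⟩ := (isPrimePow_nat_iff s).1 hs
  obtain ⟨j, rfl⟩ : ∃ j, k = j + 1 := ⟨k - 1, by omega⟩
  have := Fact.mk hp
  rw [eval_one_cyclotomic_prime_pow, hp.pow_minFac (by omega)]

theorem prod_minFac_dvd_eval_one {S : Finset ℕ} {f : ℤ[X]} (hS : ∀ s ∈ S, IsPrimePow s)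
    (h : ∀ s ∈ S, cyclotomic s ℤ ∣ f) : ((∏ s ∈ S, s.minFac : ℕ) : ℤ) ∣ f.eval 1 := by
  have h1 := eval_dvd (x := (1 : ℤ)) (prod_cyclotomic_dvd (fun s hs => (hS s hs).pos) h)
  rw [eval_prod] at h1
  rw [Nat.cast_prod]
  rwa [Finset.prod_congr rfl fun s hs => eval_one_cyclotomic_of_isPrimePow (hS s hs)] at h1

/-- Distinct cyclotomic factors are coprime, so their product divides A(x); at 1 each Φ_{p^k}
contributes p, the `minFac` of p^k. -/
theorem prod_minFac_le_card {A : Finset ℤ} (hA : A.Nonempty) {S : Finset ℕ}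
    (hS : ∀ s ∈ S, IsPrimePow s ∧ VanishesAt A s) : ∏ s ∈ S, s.minFac ≤ A.card := by
  obtain ⟨f, k, hf1, hf⟩ := exists_polynomial_charSum A
  refine Nat.le_of_dvd hA.card_pos ?_
  have := prod_minFac_dvd_eval_one (f := f) (fun s hs => (hS s hs).1) fun s hs =>
    (vanishesAt_iff_cyclotomic_dvd hf (hS s hs).1.pos).1 (hS s hs).2
  rw [hf1] at this
  exact_mod_cast this

/-! ### Prime powers dividing the period -/

/-- The prime powers dividing `n`. -/
noncomputable def primePowDivisors (n : ℕ) : Finset ℕ := by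
  classical exact n.divisors.filter IsPrimePow

theorem mem_primePowDivisors {n s : ℕ} (hn : n ≠ 0) :
    s ∈ primePowDivisors n ↔ s ∣ n ∧ IsPrimePow s := by
  simp [primePowDivisors, hn]

/-- Evaluate ∏_{1 ≠ d ∣ n} Φ_d(x) = 1 + x + … + x^(n-1) at 1; indices that are not prime powers
contribute 1. -/
theorem prod_minFac_primePowDivisors {n : ℕ} (hn : n ≠ 0) :
    ∏ s ∈ primePowDivisors n, s.minFac = n := by
  classical
  have h1 := congrArg (eval (1 : ℤ)) (prod_cyclotomic_eq_geom_sum (Nat.pos_of_ne_zero hn) ℤ)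
  rw [eval_prod] at h1
  simp only [eval_geom_sum, one_pow, Finset.sum_const, Finset.card_range, nsmul_eq_mul,
    mul_one] at h1
  have h2 : ∏ s ∈ primePowDivisors n, (cyclotomic s ℤ).eval 1 =
      ∏ s ∈ n.divisors.erase 1, (cyclotomic s ℤ).eval 1 := by
    refine Finset.prod_subset ?_ ?_
    · intro s hs
      rw [mem_primePowDivisors hn] at hs
      exact Finset.mem_erase.2 ⟨hs.2.ne_one, Nat.mem_divisors.2 ⟨hs.1, hn⟩⟩
    · intro s hs hs'
      rw [Finset.mem_erase, Nat.mem_divisors] at hs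
      rw [mem_primePowDivisors hn] at hs'
      apply eval_one_cyclotomic_not_prime_pow
      intro p hp k hk
      apply hs'
      refine ⟨hs.2.1, (isPrimePow_nat_iff s).2 ⟨p, k, hp, ?_, hk⟩⟩
      rcases Nat.eq_zero_or_pos k with rfl | h
      · exact absurd (by simpa using hk.symm) hs.1
      · exact h
  rw [← h2, Finset.prod_congr rfl fun s hs =>
    eval_one_cyclotomic_of_isPrimePow ((mem_primePowDivisors hn).1 hs).2] at h1
  exact_mod_cast h1

/-! ### Factorizations of ℤ/n and (T1) -/

theorem TilesMod.symm {n : ℕ} {A B : Finset ℤ} (h : TilesMod n A B) : TilesMod n B A := by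
  refine ⟨by rw [mul_comm, h.1], fun x => ?_⟩
  obtain ⟨a, ha, b, hb, hab⟩ := h.2 x
  exact ⟨b, hb, a, ha, by rwa [add_comm]⟩

theorem TilesMod.nonempty {n : ℕ} {A B : Finset ℤ} (h : TilesMod n A B) : A.Nonempty := by
  obtain ⟨a, ha, -⟩ := h.2 0
  exact ⟨a, ha⟩

theorem TilesMod.ne_zero {n : ℕ} {A B : Finset ℤ} (h : TilesMod n A B) : n ≠ 0 := by
  rw [← h.1]
  exact mul_ne_zero h.nonempty.card_ne_zero h.symm.nonempty.card_ne_zero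

theorem TilesMod.bijOn {n : ℕ} {A B : Finset ℤ} (h : TilesMod n A B) :
    Set.BijOn (fun x : ℤ × ℤ => ((x.1 + x.2 : ℤ) : ZMod n)) (A ×ˢ B : Finset (ℤ × ℤ)) Set.univ := by
  have : NeZero n := ⟨h.ne_zero⟩
  have hsurj : Set.SurjOn (fun x : ℤ × ℤ => ((x.1 + x.2 : ℤ) : ZMod n))
      (A ×ˢ B : Finset (ℤ × ℤ)) (Finset.univ : Finset (ZMod n)) := by
    intro y _
    obtain ⟨a, ha, b, hb, hab⟩ := h.2 (y.val : ℤ)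
    refine ⟨(a, b), by simp [ha, hb], ?_⟩
    have := (ZMod.intCast_eq_intCast_iff _ _ n).2 hab
    simpa using this
  refine ⟨Set.mapsTo_univ _ _, ?_, by simpa using hsurj⟩
  refine Finset.injOn_of_surjOn_of_card_le _ (by intro x _; simp) hsurj ?_
  simp [ZMod.card, h.1]

theorem TilesMod.inj {n : ℕ} {A B : Finset ℤ} (h : TilesMod n A B) {a a' b b' : ℤ}
    (ha : a ∈ A) (ha' : a' ∈ A) (hb : b ∈ B) (hb' : b' ∈ B) (hab : a + b ≡ a' + b' [ZMOD n]) :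
    a = a' ∧ b = b' := by
  have := h.bijOn.injOn (x₁ := (a, b)) (x₂ := (a', b')) (by simp [ha, hb]) (by simp [ha', hb'])
    ((ZMod.intCast_eq_intCast_iff _ _ n).2 hab)
  exact Prod.mk.inj this

theorem tilesMod_of_inj {n : ℕ} (hn : n ≠ 0) {A B : Finset ℤ}
    (h : ∀ x : ℤ, ∃ a ∈ A, ∃ b ∈ B, a + b ≡ x [ZMOD n])
    (hinj : ∀ a ∈ A, ∀ a' ∈ A, ∀ b ∈ B, ∀ b' ∈ B, a + b ≡ a' + b' [ZMOD n] → a = a' ∧ b = b') :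
    TilesMod n A B := by
  have : NeZero n := ⟨hn⟩
  refine ⟨?_, h⟩
  rw [← Finset.card_product, ← ZMod.card n, ← Finset.card_univ]
  refine Finset.card_nbij (fun x : ℤ × ℤ => ((x.1 + x.2 : ℤ) : ZMod n)) (by simp) ?_ ?_
  · rintro ⟨a, b⟩ h1 ⟨a', b'⟩ h2 h3
    simp only [Finset.coe_product, Set.mem_prod, Finset.mem_coe] at h1 h2
    have := hinj a h1.1 a' h2.1 b h1.2 b' h2.2 ((ZMod.intCast_eq_intCast_iff _ _ n).1 h3)
    rw [this.1, this.2]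
  · intro y _
    obtain ⟨a, ha, b, hb, hab⟩ := h (y.val : ℤ)
    refine ⟨(a, b), by simp [ha, hb], ?_⟩
    have := (ZMod.intCast_eq_intCast_iff _ _ n).2 hab
    simpa using this

theorem TilesMod.sum_eq {M : Type*} [AddCommMonoid M] {n : ℕ} [NeZero n] {A B : Finset ℤ}
    (h : TilesMod n A B) (f : ZMod n → M) :
    ∑ a ∈ A, ∑ b ∈ B, f ((a + b : ℤ) : ZMod n) = ∑ y, f y := by
  rw [← Finset.sum_product']
  refine Finset.sum_bij (fun x _ => ((x.1 + x.2 : ℤ) : ZMod n)) (by simp) ?_ ?_ (by simp)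
  · intro x hx y hy hxy
    exact h.bijOn.injOn (Finset.mem_coe.2 hx) (Finset.mem_coe.2 hy) hxy
  · intro y _
    obtain ⟨x, hx, hxy⟩ := h.bijOn.surjOn (Set.mem_univ y)
    exact ⟨x, Finset.mem_coe.1 hx, hxy⟩

theorem TilesMod.charSum_mul_eq_zero {n : ℕ} {A B : Finset ℤ} (h : TilesMod n A B) {z : ℂ}
    (hz : z ^ n = 1) (hz1 : z ≠ 1) : charSum A z * charSum B z = 0 := by
  have : NeZero n := ⟨h.ne_zero⟩
  have hz0 : z ≠ 0 := by
    rintro rfl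
    simp [h.ne_zero] at hz
  have key : ∀ m : ℤ, z ^ ((m : ZMod n).val) = z ^ m := by
    intro m
    rw [← zpow_natCast, ZMod.val_intCast]
    conv_rhs => rw [← Int.emod_add_mul_ediv m n, zpow_add₀ hz0, zpow_mul, zpow_natCast, hz,
      one_zpow, mul_one]
  have h1 := h.sum_eq (fun y => z ^ y.val)
  simp only [key] at h1
  rw [charSum, charSum, Finset.sum_mul_sum]
  simp only [zpow_add₀ hz0] at h1
  rw [h1]
  have h2 : ∑ y : ZMod n, z ^ y.val = ∑ i ∈ Finset.range n, z ^ i := by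
    refine Finset.sum_bij (fun y _ => y.val) (by simp [ZMod.val_lt]) ?_ ?_ (by simp)
    · intro x _ y _ hxy
      exact ZMod.val_injective n hxy
    · intro i hi
      exact ⟨(i : ZMod n), by simp, ZMod.val_cast_of_lt (Finset.mem_range.1 hi)⟩
  rw [h2, geom_sum_eq hz1, hz]
  simp

theorem TilesMod.vanishesAt_or {n : ℕ} {A B : Finset ℤ} (h : TilesMod n A B) {s : ℕ}
    (hs : s ∣ n) (hs1 : s ≠ 1) : VanishesAt A s ∨ VanishesAt B s := by
  have hs0 : s ≠ 0 := fun h0 => h.ne_zero (Nat.eq_zero_of_zero_dvd (h0 ▸ hs))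
  have hz := Complex.isPrimitiveRoot_exp s hs0
  have h1 := h.charSum_mul_eq_zero ((hz.pow_eq_one_iff_dvd n).2 hs) (hz.ne_one (by omega))
  rcases mul_eq_zero.1 h1 with h2 | h2
  · exact Or.inl (vanishesAt_of_charSum_eq_zero (by omega) hz h2)
  · exact Or.inr (vanishesAt_of_charSum_eq_zero (by omega) hz h2)

theorem TilesMod.prod_minFac_mul_le {n : ℕ} {A B : Finset ℤ} (h : TilesMod n A B)
    {S T : Finset ℕ} (hS : ∀ s ∈ S, IsPrimePow s ∧ VanishesAt A s)
    (hT : ∀ s ∈ T, IsPrimePow s ∧ VanishesAt B s) :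
    (∏ s ∈ S ∪ T, s.minFac) * ∏ s ∈ S ∩ T, s.minFac ≤ n := by
  rw [Finset.prod_union_inter, ← h.1]
  exact Nat.mul_le_mul (prod_minFac_le_card h.nonempty hS) (prod_minFac_le_card h.symm.nonempty hT)

theorem prod_minFac_mono {S T : Finset ℕ} (h : S ⊆ T) :
    ∏ s ∈ S, s.minFac ≤ ∏ s ∈ T, s.minFac :=
  Finset.prod_le_prod_of_subset_of_one_le' h fun s _ _ => Nat.minFac_pos s

/-- The prime powers dividing n are all used by A or B and already account for n = #A · #B. One that
does not divide n, or is used twice, would contribute a further factor of at least 2. -/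
theorem TilesMod.vanishesAt_iff {n : ℕ} {A B : Finset ℤ} (h : TilesMod n A B) {s : ℕ}
    (hs : IsPrimePow s) : VanishesAt A s ↔ s ∣ n ∧ ¬ VanishesAt B s := by
  classical
  refine ⟨fun hA => ?_, fun hB => (h.vanishesAt_or hB.1 hs.ne_one).resolve_right hB.2⟩
  set S := insert s ((primePowDivisors n).filter (VanishesAt A)) with hS
  set T := (primePowDivisors n).filter (VanishesAt B) with hT
  have hS' : ∀ t ∈ S, IsPrimePow t ∧ VanishesAt A t := by
    intro t ht
    rcases Finset.mem_insert.1 ht with rfl | ht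
    · exact ⟨hs, hA⟩
    · rw [Finset.mem_filter, mem_primePowDivisors h.ne_zero] at ht
      exact ⟨ht.1.2, ht.2⟩
  have hT' : ∀ t ∈ T, IsPrimePow t ∧ VanishesAt B t := by
    intro t ht
    rw [Finset.mem_filter, mem_primePowDivisors h.ne_zero] at ht
    exact ⟨ht.1.2, ht.2⟩
  have hle := h.prod_minFac_mul_le hS' hT'
  have hsub : primePowDivisors n ⊆ S ∪ T := by
    intro t ht
    have ht' := (mem_primePowDivisors h.ne_zero).1 ht
    rcases h.vanishesAt_or ht'.1 ht'.2.ne_one with h1 | h1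
    · exact Finset.mem_union_left _ (Finset.mem_insert_of_mem (Finset.mem_filter.2 ⟨ht, h1⟩))
    · exact Finset.mem_union_right _ (Finset.mem_filter.2 ⟨ht, h1⟩)
  have hpos := Nat.pos_of_ne_zero h.ne_zero
  have hs2 : 2 ≤ s.minFac := (Nat.minFac_prime hs.ne_one).two_le
  have hsS : s ∈ S := Finset.mem_insert_self _ _
  have hsn : s ∈ primePowDivisors n := by
    by_contra hnot
    have h1 : ∏ t ∈ insert s (primePowDivisors n), t.minFac ≤ ∏ t ∈ S ∪ T, t.minFac :=
      prod_minFac_mono (Finset.insert_subset (Finset.mem_union_left _ hsS) hsub)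
    rw [Finset.prod_insert hnot, prod_minFac_primePowDivisors h.ne_zero] at h1
    have h2 : 1 ≤ ∏ t ∈ S ∩ T, t.minFac := Finset.prod_pos fun t _ => Nat.minFac_pos t
    have h3 := Nat.mul_le_mul h1 h2
    nlinarith
  refine ⟨((mem_primePowDivisors h.ne_zero).1 hsn).1, fun hB => ?_⟩
  have h1 := prod_minFac_mono hsub
  rw [prod_minFac_primePowDivisors h.ne_zero] at h1
  have h2 : s.minFac ≤ ∏ t ∈ S ∩ T, t.minFac :=
    Finset.single_le_prod' (f := fun t : ℕ => t.minFac) (fun t _ => Nat.minFac_pos t)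
      (Finset.mem_inter.2 ⟨hsS, Finset.mem_filter.2 ⟨hsn, hB⟩⟩)
  have h3 := Nat.mul_le_mul h1 h2
  nlinarith

theorem TilesMod.prod_minFac_eq_card {n : ℕ} {A B : Finset ℤ} (h : TilesMod n A B)
    {S : Finset ℕ} (hS : ∀ s, s ∈ S ↔ IsPrimePow s ∧ VanishesAt A s) :
    ∏ s ∈ S, s.minFac = A.card := by
  classical
  set T := (primePowDivisors n).filter (VanishesAt B) with hT
  have hT' : ∀ t ∈ T, IsPrimePow t ∧ VanishesAt B t := by
    intro t ht
    rw [Finset.mem_filter, mem_primePowDivisors h.ne_zero] at ht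
    exact ⟨ht.1.2, ht.2⟩
  have hSA := prod_minFac_le_card h.nonempty fun s hs => (hS s).1 hs
  have hTB := prod_minFac_le_card h.symm.nonempty hT'
  have hsub : primePowDivisors n ⊆ S ∪ T := by
    intro t ht
    have ht' := (mem_primePowDivisors h.ne_zero).1 ht
    rcases h.vanishesAt_or ht'.1 ht'.2.ne_one with h1 | h1
    · exact Finset.mem_union_left _ ((hS t).2 ⟨ht'.2, h1⟩)
    · exact Finset.mem_union_right _ (Finset.mem_filter.2 ⟨ht, h1⟩)
  have h1 : n ≤ ∏ s ∈ S ∪ T, s.minFac := by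
    exact (prod_minFac_primePowDivisors h.ne_zero).ge.trans (prod_minFac_mono hsub)
  have h2 : 1 ≤ ∏ t ∈ S ∩ T, t.minFac := Finset.prod_pos fun t _ => Nat.minFac_pos t
  have h3 := Finset.prod_union_inter (s₁ := S) (s₂ := T) (f := fun s : ℕ => s.minFac)
  have hB := h.symm.nonempty.card_pos
  have h4 : A.card * B.card ≤ (∏ s ∈ S, s.minFac) * B.card := by
    rw [h.1]
    calc n ≤ (∏ s ∈ S ∪ T, s.minFac) * ∏ t ∈ S ∩ T, t.minFac := by nlinarith
      _ = (∏ s ∈ S, s.minFac) * ∏ s ∈ T, s.minFac := h3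
      _ ≤ _ := Nat.mul_le_mul_left _ hTB
  exact le_antisymm hSA (Nat.le_of_mul_le_mul_right h4 hB)

/-! ### Multiplying a tile by an integer prime to its cardinality -/

/-- Frobenius in the group ring 𝔽_l[ℤ/n]: if f, g represent A, B and N is the sum of all group
elements, then fg = N. Hence f^l g = (#A)^(l-1) N = N by Fermat, while f^l represents lA. All
coefficients of N are nonzero, so lA + B covers ℤ/n. -/
theorem TilesMod.image_prime_mul {n : ℕ} {A B : Finset ℤ} (h : TilesMod n A B) {l : ℕ}
    (hl : l.Prime) (hlA : ¬ l ∣ A.card) : TilesMod n (A.image fun a => (l : ℤ) * a) B := by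
  classical
  have : NeZero n := ⟨h.ne_zero⟩
  have : Fact l.Prime := ⟨hl⟩
  have hl0 : (l : ℤ) ≠ 0 := by exact_mod_cast hl.ne_zero
  refine ⟨by rw [Finset.card_image_of_injective _ (mul_right_injective₀ hl0), h.1], fun x => ?_⟩
  let e : ZMod n → AddMonoidAlgebra (ZMod l) (ZMod n) := fun y => AddMonoidAlgebra.single y 1
  have he : ∀ y y', e (y + y') = e y * e y' := fun y y' => by
    simp [e, AddMonoidAlgebra.single_mul_single]
  set f := ∑ a ∈ A, e (a : ZMod n) with hf
  set g := ∑ b ∈ B, e (b : ZMod n) with hg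
  set N := ∑ y, e y with hN
  have hfg : f * g = N := by
    rw [hf, hg, Finset.sum_mul_sum, hN, ← h.sum_eq e]
    simp only [← he, Int.cast_add]
  have heN : ∀ y, e y * N = N := fun y => by
    rw [hN, Finset.mul_sum]
    simp only [← he]
    exact Fintype.sum_equiv (Equiv.addLeft y) _ _ fun _ => rfl
  have hfN : f * N = (A.card : ZMod l) • N := by
    rw [hf, Finset.sum_mul, Finset.sum_eq_card_nsmul fun a _ => heN _, Nat.cast_smul_eq_nsmul]
  have hfkN : ∀ k : ℕ, f ^ k * N = (A.card : ZMod l) ^ k • N := by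
    intro k
    induction k with
    | zero => simp
    | succ k ih => rw [pow_succ', mul_assoc, ih, mul_smul_comm, hfN, smul_smul, ← pow_succ]
  have hcard : (A.card : ZMod l) ≠ 0 := by
    rwa [Ne, ZMod.natCast_eq_zero_iff]
  have hflg : f ^ l * g = N := by
    have h1 : f ^ l * g = f ^ (l - 1) * (f * g) := by
      rw [← mul_assoc, ← pow_succ, Nat.sub_add_cancel hl.one_le]
    rw [h1, hfg, hfkN, ZMod.pow_card_sub_one_eq_one hcard, one_smul]
  have : CharP (AddMonoidAlgebra (ZMod l) (ZMod n)) l :=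
    charP_of_injective_algebraMap (algebraMap (ZMod l) _).injective l
  have hepow : ∀ (y : ZMod n) (k : ℕ), e y ^ k = e (k * y) := by
    intro y k
    induction k with
    | zero => simp [e, AddMonoidAlgebra.one_def]
    | succ k ih => rw [pow_succ, ih, ← he]; congr 1; push_cast; ring
  have hfl : f ^ l = ∑ a ∈ A, e ((l * a : ℤ) : ZMod n) := by
    rw [hf, sum_pow_char]
    refine Finset.sum_congr rfl fun a _ => ?_
    rw [hepow]
    push_cast
    rfl
  by_contra hx
  push Not at hx
  have h2 := congrArg (fun F => F.coeff (x : ZMod n)) hflg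
  simp only [hfl, hg, hN, Finset.sum_mul_sum, ← he, AddMonoidAlgebra.coeff_sum,
    Finsupp.finsetSum_apply, e, AddMonoidAlgebra.coeff_single, Finsupp.single_apply] at h2
  rw [Finset.sum_eq_zero, Finset.sum_ite_eq' Finset.univ, if_pos (Finset.mem_univ _)] at h2
  · exact zero_ne_one h2
  · intro a ha
    refine Finset.sum_eq_zero fun b hb => if_neg fun hab => ?_
    refine hx _ (Finset.mem_image_of_mem _ ha) b hb ((ZMod.intCast_eq_intCast_iff _ _ n).1 ?_)
    rw [← hab]
    push_cast
    rfl

theorem TilesMod.image_mul {n : ℕ} {A B : Finset ℤ} (h : TilesMod n A B) {r : ℕ} (hr : r ≠ 0)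
    (hrA : r.Coprime A.card) : TilesMod n (A.image fun a => (r : ℤ) * a) B := by
  induction r using induction_on_primes with
  | zero => exact absurd rfl hr
  | one => simpa using h
  | prime_mul p r hp ih =>
    have hr0 : r ≠ 0 := right_ne_zero_of_mul hr
    have h1 := ih hr0 (Nat.Coprime.coprime_mul_left hrA)
    have h2 : (A.image fun a => (r : ℤ) * a).card = A.card :=
      Finset.card_image_of_injective _ (mul_right_injective₀ (by exact_mod_cast hr0))
    have h3 := h1.image_prime_mul hp (by
      rw [h2]
      exact (hp.coprime_iff_not_dvd).1 (Nat.Coprime.coprime_mul_right hrA))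
    rw [Finset.image_image] at h3
    simpa [Function.comp_def, mul_assoc] using h3

/-! ### Passing to a residue class and dividing by the modulus -/

/-- The set of integers `x` with `l + r * x ∈ A`. -/
noncomputable def residueQuotient (r : ℕ) (A : Finset ℤ) (l : ℤ) : Finset ℤ :=
  {a ∈ A | a ≡ l [ZMOD r]}.image fun a => (a - l) / r

theorem mem_residueQuotient {r : ℕ} (hr : r ≠ 0) {A : Finset ℤ} {l x : ℤ} :
    x ∈ residueQuotient r A l ↔ l + r * x ∈ A := by
  have hr' : (r : ℤ) ≠ 0 := by exact_mod_cast hr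
  simp only [residueQuotient, Finset.mem_image, Finset.mem_filter]
  constructor
  · rintro ⟨a, ⟨ha, hal⟩, rfl⟩
    rwa [Int.mul_ediv_cancel' hal.symm.dvd, add_sub_cancel]
  · intro h
    refine ⟨l + r * x, ⟨h, ?_⟩, ?_⟩
    · exact (Int.modEq_iff_dvd.2 ⟨x, by ring⟩ : l ≡ l + r * x [ZMOD r]).symm
    · rw [add_sub_cancel_left, Int.mul_ediv_cancel_left _ hr']

theorem zpow_mul_charSum_residueQuotient {r : ℕ} (hr : r ≠ 0) (A : Finset ℤ) (l : ℤ) {z : ℂ}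
    (hz : z ≠ 0) : z ^ l * charSum (residueQuotient r A l) (z ^ r) =
      ∑ a ∈ A with a ≡ l [ZMOD r], z ^ a := by
  rw [charSum, Finset.mul_sum]
  refine Finset.sum_bij (fun x _ => l + r * x) ?_ ?_ ?_ ?_
  · intro x hx
    rw [mem_residueQuotient hr] at hx
    exact Finset.mem_filter.2
      ⟨hx, (Int.modEq_iff_dvd.2 ⟨x, by ring⟩ : l ≡ l + r * x [ZMOD r]).symm⟩
  · intro x _ y _ hxy
    have hr' : (r : ℤ) ≠ 0 := by exact_mod_cast hr
    exact mul_left_cancel₀ hr' (add_left_cancel hxy)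
  · intro a ha
    obtain ⟨ha, hal⟩ := Finset.mem_filter.1 ha
    obtain ⟨x, hx⟩ := hal.symm.dvd
    have hx' : l + r * x = a := by rw [← hx]; ring
    exact ⟨x, (mem_residueQuotient hr).2 (by rwa [hx']), hx'⟩
  · intro x _
    rw [zpow_add₀ hz, zpow_mul, zpow_natCast]

theorem charSum_eq_zpow_mul {r : ℕ} (hr : r ≠ 0) {A : Finset ℤ} {l : ℤ}
    (hA : ∀ a ∈ A, a ≡ l [ZMOD r]) {z : ℂ} (hz : z ≠ 0) :
    charSum A z = z ^ l * charSum (residueQuotient r A l) (z ^ r) := by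
  rw [zpow_mul_charSum_residueQuotient hr A l hz, Finset.filter_true_of_mem hA, charSum]

theorem charSum_eq_sum_range {r : ℕ} (hr : r ≠ 0) (A : Finset ℤ) {z : ℂ} (hz : z ≠ 0) :
    charSum A z =
      ∑ l ∈ Finset.range r, z ^ (l : ℤ) * charSum (residueQuotient r A l) (z ^ r) := by
  have hr' : (r : ℤ) ≠ 0 := by exact_mod_cast hr
  have h0 : ∀ a : ℤ, ((a % r).toNat : ℤ) = a % r := fun a =>
    Int.toNat_of_nonneg (Int.emod_nonneg a hr')
  rw [charSum, ← Finset.sum_fiberwise_of_maps_to (s := A) (t := Finset.range r)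
    (g := fun a => (a % r).toNat)]
  · refine Finset.sum_congr rfl fun l hl => ?_
    rw [zpow_mul_charSum_residueQuotient hr A l hz]
    refine Finset.sum_congr (Finset.filter_congr fun a _ => ?_) fun _ _ => rfl
    rw [Int.ModEq, Int.emod_eq_of_lt (a := (l : ℤ)) (by omega)
      (by have := Finset.mem_range.1 hl; omega), ← h0 a]
    exact Nat.cast_inj.symm
  · intro a _
    have := Int.emod_lt_of_pos a (by omega : (0 : ℤ) < r)
    have := h0 a
    exact Finset.mem_range.2 (by omega)

/-- With A in a single class modulo r, translates by elements of B in different classes do not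
interact, so each class of B separately complements A. -/
theorem TilesMod.residueQuotient {r m : ℕ} {A B : Finset ℤ} (h : TilesMod (r * m) A B) {k : ℤ}
    (hA : ∀ a ∈ A, a ≡ k [ZMOD r]) (l : ℤ) :
    TilesMod m (residueQuotient r A k) (residueQuotient r B l) := by
  have hr : r ≠ 0 := left_ne_zero_of_mul h.ne_zero
  have hr' : (r : ℤ) ≠ 0 := by exact_mod_cast hr
  refine tilesMod_of_inj (right_ne_zero_of_mul h.ne_zero) ?_ ?_
  · intro x
    obtain ⟨a, ha, b, hb, hab⟩ := h.2 (k + l + r * x)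
    push_cast at hab
    obtain ⟨a', ha'⟩ := (hA a ha).symm.dvd
    obtain ⟨c, hc⟩ := hab.symm.dvd
    have hb' : l + r * (x - a' + m * c) = b := by linear_combination -hc + ha'
    have ha'' : k + r * a' = a := by linear_combination -ha'
    refine ⟨a', (mem_residueQuotient hr).2 (by rwa [ha'']), x - a' + m * c,
      (mem_residueQuotient hr).2 (by rwa [hb']), ?_⟩
    exact (Int.modEq_iff_dvd.2 ⟨c, by ring⟩ : x ≡ a' + (x - a' + m * c) [ZMOD m]).symm
  · intro a ha a' ha' b hb b' hb' hab
    rw [mem_residueQuotient hr] at ha ha' hb hb'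
    obtain ⟨c, hc⟩ := hab.dvd
    have := h.inj ha ha' hb hb' (Int.modEq_iff_dvd.2 ⟨c, by push_cast; linear_combination r * hc⟩)
    exact ⟨mul_left_cancel₀ hr' (add_left_cancel this.1),
      mul_left_cancel₀ hr' (add_left_cancel this.2)⟩

theorem vanishesAt_iff_residueQuotient {r : ℕ} (hr : r ≠ 0) {A : Finset ℤ} {k : ℤ}
    (hA : ∀ a ∈ A, a ≡ k [ZMOD r]) {s t : ℕ} (hs : 0 < s) (ht : 0 < t)
    (hst : ∀ z : ℂ, IsPrimitiveRoot z s → IsPrimitiveRoot (z ^ r) t) :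
    VanishesAt A s ↔ VanishesAt (residueQuotient r A k) t := by
  constructor
  · intro h
    have hz := Complex.isPrimitiveRoot_exp s hs.ne'
    have h1 := h _ hz
    have hz0 := hz.ne_zero hs.ne'
    rw [charSum_eq_zpow_mul hr hA hz0] at h1
    exact vanishesAt_of_charSum_eq_zero ht (hst _ hz)
      ((mul_eq_zero.1 h1).resolve_left (zpow_ne_zero _ hz0))
  · intro h z hz
    rw [charSum_eq_zpow_mul hr hA (hz.ne_zero hs.ne'), h _ (hst z hz), mul_zero]

theorem vanishesAt_of_residueQuotient {r : ℕ} (hr : r ≠ 0) {A : Finset ℤ} {s t : ℕ} (hs : 0 < s)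
    (hst : ∀ z : ℂ, IsPrimitiveRoot z s → IsPrimitiveRoot (z ^ r) t)
    (h : ∀ l : ℤ, VanishesAt (residueQuotient r A l) t) : VanishesAt A s := by
  intro z hz
  rw [charSum_eq_sum_range hr A (hz.ne_zero hs.ne')]
  exact Finset.sum_eq_zero fun l _ => by rw [h l _ (hst z hz), mul_zero]

/-! ### (T2) for two primes -/

/-- Condition (T2) for powers of the two primes `p` and `q`. -/
def VanishesAtProducts (p q : ℕ) (A : Finset ℤ) : Prop :=
  ∀ i j : ℕ, 0 < i → 0 < j → VanishesAt A (p ^ i) → VanishesAt A (q ^ j) →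
    VanishesAt A (p ^ i * q ^ j)

theorem VanishesAtProducts.symm {p q : ℕ} {A : Finset ℤ} (h : VanishesAtProducts p q A) :
    VanishesAtProducts q p A := fun i j hi hj h1 h2 => by
  rw [mul_comm]
  exact h j i hj hi h2 h1

theorem isPrimitiveRoot_pow_prime {p i s : ℕ} (hp : p.Prime) (hs : 0 < s) {z : ℂ}
    (hz : IsPrimitiveRoot z (p ^ (i + 1) * s)) : IsPrimitiveRoot (z ^ p) (p ^ i * s) :=
  hz.pow (Nat.mul_pos (pow_pos hp.pos _) hs) (by ring)

theorem not_vanishesAt_one {A : Finset ℤ} (hA : A.Nonempty) : ¬ VanishesAt A 1 := by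
  intro h
  have := h 1 IsPrimitiveRoot.one
  rw [charSum_one] at this
  exact hA.card_ne_zero (by exact_mod_cast this)

/-- Let A' be the quotient of A by p. Vanishing of A at p^(i+1) q^j amounts to vanishing of A' at
p^i q^j, and i = 0 cannot arise in (T2) for A, since A' does not vanish at 1. For B, prime powers
used by B are not used by A, so A' does not vanish at p^i or q^j. Every quotient of B complements
A', hence vanishes at q^j, and at p^i when i > 0; induction applies to each. -/
theorem TilesMod.vanishesAtProducts_of_modEq {p q m : ℕ} (hp : p.Prime) (hq : q.Prime)
    (hpq : p ≠ q) {A B : Finset ℤ} (h : TilesMod (p * m) A B) {k : ℤ}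
    (hA : ∀ a ∈ A, a ≡ k [ZMOD p])
    (ih : ∀ A' B', TilesMod m A' B' → VanishesAtProducts p q A') :
    VanishesAtProducts p q A ∧ VanishesAtProducts p q B := by
  have hp0 := hp.ne_zero
  have hpow : ∀ i, VanishesAt A (p ^ (i + 1)) ↔
      VanishesAt (CovenMeyerowitz.residueQuotient p A k) (p ^ i) := fun i => by
    have := vanishesAt_iff_residueQuotient hp0 hA (s := p ^ (i + 1) * 1) (t := p ^ i * 1)
      (by simpa using pow_pos hp.pos _) (by simpa using pow_pos hp.pos _)
      fun z hz => isPrimitiveRoot_pow_prime hp one_pos hz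
    simpa using this
  have hcop : ∀ j, p.Coprime (q ^ j) := fun j =>
    Nat.Coprime.pow_right j ((Nat.coprime_primes hp hq).2 hpq)
  have hqpow : ∀ j, VanishesAt A (q ^ j) ↔
      VanishesAt (CovenMeyerowitz.residueQuotient p A k) (q ^ j) := fun j =>
    vanishesAt_iff_residueQuotient hp0 hA (pow_pos hq.pos _) (pow_pos hq.pos _)
      fun z hz => hz.pow_of_coprime p (hcop j)
  have hpos : ∀ i j, 0 < p ^ i * q ^ j := fun i j =>
    Nat.mul_pos (pow_pos hp.pos _) (pow_pos hq.pos _)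
  have hmul : ∀ i j (z : ℂ), IsPrimitiveRoot z (p ^ (i + 1) * q ^ j) →
      IsPrimitiveRoot (z ^ p) (p ^ i * q ^ j) := fun i j z hz =>
    isPrimitiveRoot_pow_prime hp (pow_pos hq.pos _) hz
  constructor
  · intro i j hi hj hAp hAq
    obtain ⟨i, rfl⟩ : ∃ i', i = i' + 1 := ⟨i - 1, by omega⟩
    have h' := h.residueQuotient hA 0
    rw [vanishesAt_iff_residueQuotient hp0 hA (hpos _ _) (hpos _ _) (hmul i j)]
    rw [hpow] at hAp
    rw [hqpow] at hAq
    rcases Nat.eq_zero_or_pos i with rfl | hi'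
    · exact absurd hAp (not_vanishesAt_one h'.nonempty)
    · exact ih _ _ h' i j hi' hj hAp hAq
  · intro i j hi hj hBp hBq
    obtain ⟨i, rfl⟩ : ∃ i', i = i' + 1 := ⟨i - 1, by omega⟩
    obtain ⟨hpn, hAp⟩ := (h.symm.vanishesAt_iff (hp.isPrimePow.pow (by omega))).1 hBp
    obtain ⟨hqn, hAq⟩ := (h.symm.vanishesAt_iff (hq.isPrimePow.pow (by omega))).1 hBq
    rw [hpow] at hAp
    rw [hqpow] at hAq
    have hpm : p ^ i ∣ m := by
      rw [pow_succ'] at hpn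
      exact Nat.dvd_of_mul_dvd_mul_left hp.pos hpn
    have hqm : q ^ j ∣ m := (hcop j).symm.dvd_of_dvd_mul_left hqn
    refine vanishesAt_of_residueQuotient hp0 (hpos _ _) (hmul i j) fun l => ?_
    have h' := h.residueQuotient hA l
    have hBq' := (h'.vanishesAt_or hqm (hq.isPrimePow.pow (by omega)).ne_one).resolve_left hAq
    rcases Nat.eq_zero_or_pos i with rfl | hi'
    · simpa using hBq'
    · exact ih _ _ h'.symm i j hi' hj
        ((h'.vanishesAt_or hpm (hp.isPrimePow.pow (by omega)).ne_one).resolve_left hAp) hBq'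

/-- Take y distinct from x modulo p and w distinct from x modulo q. If neither pair works, then y ≡
x modulo q and w ≡ x modulo p, so the pair y, w does. -/
theorem exists_not_dvd_sub {A : Finset ℤ} (hA : A.Nonempty) {p q : ℤ}
    (hp : ¬ ∃ k, ∀ a ∈ A, a ≡ k [ZMOD p]) (hq : ¬ ∃ k, ∀ a ∈ A, a ≡ k [ZMOD q]) :
    ∃ a ∈ A, ∃ a' ∈ A, ¬ p ∣ a - a' ∧ ¬ q ∣ a - a' := by
  push Not at hp hq
  obtain ⟨x, hx⟩ := hA
  obtain ⟨y, hy, hyx⟩ := hp x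
  obtain ⟨w, hw, hwx⟩ := hq x
  simp only [Int.modEq_iff_dvd] at hyx hwx
  by_cases h1 : q ∣ x - y
  · by_cases h2 : p ∣ x - w
    · refine ⟨y, hy, w, hw, fun h3 => hyx ?_, fun h3 => hwx ?_⟩
      · have := dvd_sub h2 h3
        rwa [show x - w - (y - w) = x - y by ring] at this
      · have := dvd_add h1 h3
        rwa [show x - y + (y - w) = x - w by ring] at this
    · exact ⟨x, hx, w, hw, h2, hwx⟩
  · exact ⟨x, hx, y, hy, hyx, h1⟩

/-- Sands' theorem on factorizations of cyclic groups whose order has two prime factors. -/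
theorem TilesMod.exists_modEq {n p q : ℕ} (hp : p.Prime) (hpn : p ∣ n)
    (hn : ∀ l : ℕ, l.Prime → l ∣ n → l = p ∨ l = q) {A B : Finset ℤ} (h : TilesMod n A B) :
    ((∃ k, ∀ a ∈ A, a ≡ k [ZMOD p]) ∨ ∃ k, ∀ a ∈ A, a ≡ k [ZMOD q]) ∨
      (∃ k, ∀ b ∈ B, b ≡ k [ZMOD p]) ∨ ∃ k, ∀ b ∈ B, b ≡ k [ZMOD q] := by
  by_contra hcon
  simp only [not_or] at hcon
  obtain ⟨a, ha, a', ha', hap, haq⟩ := exists_not_dvd_sub h.nonempty hcon.1.1 hcon.1.2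
  obtain ⟨b, hb, b', hb', hbp, hbq⟩ := exists_not_dvd_sub h.symm.nonempty hcon.2.1 hcon.2.2
  have : NeZero n := ⟨h.ne_zero⟩
  have hunit : ∀ u : ℤ, ¬ (p : ℤ) ∣ u → ¬ (q : ℤ) ∣ u → IsUnit (u : ZMod n) := by
    intro u hup huq
    rw [ZMod.coe_int_isUnit_iff_isCoprime, Int.isCoprime_iff_gcd_eq_one]
    refine Nat.coprime_of_dvd fun l hl hln hlu => ?_
    rw [Int.natAbs_natCast] at hln
    rw [← Int.natCast_dvd] at hlu
    rcases hn l hl hln with rfl | rfl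
    · exact hup hlu
    · exact huq hlu
  obtain ⟨u, hu⟩ := hunit _ hap haq
  obtain ⟨v, hv⟩ := hunit _ hbp hbq
  -- This r satisfies r(a - a') = b - b' in ℤ/n, so ra + b' = ra' + b is a collision in the tiling
  -- by rA and B.
  set r := ((v * u⁻¹ : (ZMod n)ˣ) : ZMod n).val with hr
  have hrn : r.Coprime n := ZMod.val_coe_unit_coprime _
  have hr0 : r ≠ 0 := by
    intro h0
    rw [h0, Nat.coprime_zero_left] at hrn
    exact hp.one_lt.ne' (Nat.dvd_one.1 (hrn ▸ hpn))
  have hT := h.image_mul hr0 (hrn.coprime_dvd_right ⟨_, h.1.symm⟩)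
  have hru : (r : ZMod n) * (a - a') = b - b' := by
    rw [hr, ZMod.natCast_zmod_val]
    push_cast at hu hv
    rw [← hu, ← hv, ← Units.val_mul, inv_mul_cancel_right]
  have h1 := hT.inj (Finset.mem_image_of_mem _ ha) (Finset.mem_image_of_mem _ ha') hb' hb
    ((ZMod.intCast_eq_intCast_iff _ _ n).1 (by push_cast; linear_combination hru))
  apply hbp
  rw [h1.2, sub_self]
  exact dvd_zero _

theorem TilesMod.vanishesAtProducts {n p q : ℕ} (hp : p.Prime) (hq : q.Prime) (hpq : p ≠ q)
    (hn : ∀ l : ℕ, l.Prime → l ∣ n → l = p ∨ l = q) {A B : Finset ℤ} (h : TilesMod n A B) :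
    VanishesAtProducts p q A := by
  induction n using Nat.strong_induction_on generalizing A B with
  | _ n ih =>
    intro i j hi hj hAp hAq
    have hpn : p ∣ n := (dvd_pow_self p hi.ne').trans
      ((h.vanishesAt_iff (hp.isPrimePow.pow hi.ne')).1 hAp).1
    have hqn : q ∣ n := (dvd_pow_self q hj.ne').trans
      ((h.vanishesAt_iff (hq.isPrimePow.pow hj.ne')).1 hAq).1
    have hih : ∀ l m : ℕ, l.Prime → n = l * m → ∀ A' B', TilesMod m A' B' →
        VanishesAtProducts p q A' := by
      rintro l m hl rfl A' B' h'
      refine ih m ?_ (fun l' hl' hd => hn l' hl' (dvd_mul_of_dvd_right hd _)) h'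
      have := hl.two_le
      have := h'.ne_zero
      nlinarith [Nat.pos_of_ne_zero this]
    suffices VanishesAtProducts p q A from this i j hi hj hAp hAq
    obtain ⟨m, hm⟩ := hpn
    obtain ⟨m', hm'⟩ := hqn
    have ihp := hih p m hp hm
    have ihq : ∀ A' B', TilesMod m' A' B' → VanishesAtProducts q p A' := fun A' B' h' =>
      (hih q m' hq hm' A' B' h').symm
    rcases h.exists_modEq hp ⟨m, hm⟩ hn with (⟨k, hk⟩ | ⟨k, hk⟩) | ⟨k, hk⟩ | ⟨k, hk⟩
    · exact ((hm ▸ h).vanishesAtProducts_of_modEq hp hq hpq hk ihp).1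
    · exact ((hm' ▸ h).vanishesAtProducts_of_modEq hq hp hpq.symm hk ihq).1.symm
    · exact ((hm ▸ h.symm).vanishesAtProducts_of_modEq hp hq hpq hk ihp).2
    · exact ((hm' ▸ h.symm).vanishesAtProducts_of_modEq hq hp hpq.symm hk ihq).2.symm

/-! ### Reducing the period; periodicity of tilings -/

/-- A tiling of the integers by `A` has a period all of whose prime factors divide `#A`. -/
theorem TilesMod.exists_dvd_card {n : ℕ} {A B : Finset ℤ} (h : TilesMod n A B) :
    ∃ m B', TilesMod m A B' ∧ ∀ l : ℕ, l.Prime → l ∣ m → l ∣ A.card := by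
  induction n using Nat.strong_induction_on generalizing B with
  | _ n ih =>
    by_cases hn : ∀ l : ℕ, l.Prime → l ∣ n → l ∣ A.card
    · exact ⟨n, B, h, hn⟩
    · push Not at hn
      obtain ⟨l, hl, ⟨m, rfl⟩, hlA⟩ := hn
      have hl0 : (l : ℤ) ≠ 0 := by exact_mod_cast hl.ne_zero
      -- lA lies in the class 0 modulo l, and its quotient by l is A again, so A tiles with the
      -- smaller period m.
      have h1 := (h.image_prime_mul hl hlA).residueQuotient (k := 0) (fun a ha => by
        obtain ⟨a', -, rfl⟩ := Finset.mem_image.1 ha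
        exact (Int.modEq_zero_iff_dvd).2 (dvd_mul_right _ _)) 0
      have h2 : CovenMeyerowitz.residueQuotient l (A.image fun a => (l : ℤ) * a) 0 = A := by
        ext x
        rw [mem_residueQuotient hl.ne_zero, zero_add, Finset.mem_image]
        exact ⟨fun ⟨a, ha, hax⟩ => mul_left_cancel₀ hl0 hax ▸ ha, fun hx => ⟨x, hx, rfl⟩⟩
      rw [h2] at h1
      refine ih m ?_ h1
      have := hl.two_le
      nlinarith [Nat.pos_of_ne_zero h1.ne_zero]

/-- Newman's theorem: a tiling of the integers by translates of a finite set is periodic. -/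
theorem exists_period {A : Finset ℤ} (hA : A.Nonempty) {C : Set ℤ}
    (hex : ∀ x : ℤ, ∃ a ∈ A, x - a ∈ C)
    (huniq : ∀ a ∈ A, ∀ a' ∈ A, ∀ c ∈ C, ∀ c' ∈ C, a + c = a' + c' → a = a') :
    ∃ n : ℕ, 0 < n ∧ ∀ c : ℤ, c ∈ C ↔ c + n ∈ C := by
  -- Membership of t in C is determined by other points of C: those to its left when k = min A,
  -- those to its right when k = max A.
  have hdet : ∀ k ∈ A, ∀ t : ℤ, t ∈ C ↔ ∀ a ∈ A, a ≠ k → t + (k - a) ∉ C := by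
    intro k hk t
    constructor
    · intro ht a ha hak hc
      exact hak (huniq a ha k hk _ hc t ht (by ring))
    · intro h
      obtain ⟨a, ha, hc⟩ := hex (t + k)
      by_cases hak : a = k
      · rwa [hak, add_sub_cancel_right] at hc
      · rw [add_sub_assoc] at hc
        exact absurd hc (h a ha hak)
  obtain ⟨k₀, hk₀, hmin⟩ := A.exists_min_image id hA
  obtain ⟨k₁, hk₁, hmax⟩ := A.exists_max_image id hA
  simp only [id] at hmin hmax
  obtain ⟨D, hD⟩ : ∃ D : ℕ, (D : ℤ) = k₁ - k₀ + 1 :=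
    ⟨(k₁ - k₀ + 1).toNat, by have := hmin k₁ hk₁; omega⟩
  -- Pigeonhole: two windows of length D = max A - min A + 1 carry the same pattern of C. The rules
  -- at min A and max A then propagate the agreement in both directions.
  obtain ⟨n, hn, m, hm⟩ : ∃ n : ℕ, 0 < n ∧ ∃ m : ℤ, ∀ i : ℤ, 0 ≤ i → i < D →
      (m + i ∈ C ↔ m + i + n ∈ C) := by
    obtain ⟨x, y, hxy, hw⟩ := Finite.exists_ne_map_eq_of_infinite
      fun (m : ℕ) (i : Fin D) => (m : ℤ) + (i : ℕ) ∈ C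
    have hw' : ∀ i : ℤ, 0 ≤ i → i < D → ((x : ℤ) + i ∈ C ↔ (y : ℤ) + i ∈ C) := by
      intro i h0 hi
      lift i to ℕ using h0
      exact iff_of_eq (congrFun hw ⟨i, by omega⟩)
    rcases lt_or_gt_of_ne hxy with hlt | hlt
    · refine ⟨y - x, by omega, x, fun i h0 hi => ?_⟩
      rw [hw' i h0 hi, show (x : ℤ) + i + (y - x : ℕ) = y + i by omega]
    · refine ⟨x - y, by omega, y, fun i h0 hi => ?_⟩
      rw [← hw' i h0 hi, show (y : ℤ) + i + (x - y : ℕ) = x + i by omega]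
  refine ⟨n, hn, fun c => ?_⟩
  have hall : ∀ j : ℤ, ∀ i : ℤ, 0 ≤ i → i < D → (m + j + i ∈ C ↔ m + j + i + n ∈ C) := by
    intro j
    induction j using Int.induction_on with
    | zero => simpa using hm
    | succ j ih =>
      intro i h0 hi
      rcases lt_or_ge (i + 1) D with h1 | h1
      · have := ih (i + 1) (by omega) h1
        rwa [show m + j + (i + 1) = m + (j + 1) + i by ring] at this
      · rw [hdet k₀ hk₀, hdet k₀ hk₀]
        refine forall₃_congr fun a ha hak => not_congr ?_
        have h2 := hmin a ha
        have h3 := hmax a ha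
        have := ih (i + 1 + (k₀ - a)) (by omega) (by omega)
        rwa [show m + j + (i + 1 + (k₀ - a)) = m + (j + 1) + i + (k₀ - a) by ring,
          show m + (j + 1) + i + (k₀ - a) + n = m + (j + 1) + i + n + (k₀ - a) by ring] at this
    | pred j ih =>
      intro i h0 hi
      rcases lt_or_ge 0 i with h1 | h1
      · have := ih (i - 1) (by omega) (by omega)
        rwa [show m + -j + (i - 1) = m + (-j - 1) + i by ring] at this
      · rw [hdet k₁ hk₁, hdet k₁ hk₁]
        refine forall₃_congr fun a ha hak => not_congr ?_
        have h2 := hmin a ha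
        have h3 := hmax a ha
        have := ih (i - 1 + (k₁ - a)) (by omega) (by omega)
        rwa [show m + -j + (i - 1 + (k₁ - a)) = m + (-j - 1) + i + (k₁ - a) by ring,
          show m + (-j - 1) + i + (k₁ - a) + n = m + (-j - 1) + i + n + (k₁ - a) by ring] at this
  have hD0 : (0 : ℤ) < D := by have := hmin k₁ hk₁; omega
  simpa using hall (c - m) 0 le_rfl hD0

/-! ### From sets of natural numbers to `TilesMod` -/

/-- The finite set of integers underlying `A`. -/
def intSet (A : Finset ℕ) : Finset ℤ := A.map Nat.castEmbedding

theorem mem_intSet {A : Finset ℕ} {x : ℤ} :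
    x ∈ intSet A ↔ x ∈ (fun a : ℕ => (a : ℤ)) '' (A : Set ℕ) := by
  simp [intSet]

theorem TilesIntegers.exists_tilesMod {A : Finset ℕ} (hA : A.Nonempty) (h : TilesIntegers A) :
    ∃ n B, TilesMod n (intSet A) B := by
  classical
  obtain ⟨C, hC⟩ := h
  simp only [← mem_intSet] at hC
  have huniq : ∀ a ∈ intSet A, ∀ a' ∈ intSet A, ∀ c ∈ C, ∀ c' ∈ C, a + c = a' + c' → a = a' := by
    intro a ha a' ha' c hc c' hc' hac
    have := (hC (a + c)).unique (y₁ := (a, c)) (y₂ := (a', c')) ⟨ha, hc, rfl⟩ ⟨ha', hc', hac.symm⟩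
    exact congrArg Prod.fst this
  obtain ⟨n, hn, hper⟩ := exists_period (A := intSet A) (by simpa [intSet] using hA) (C := C)
    (fun x => by
      obtain ⟨⟨a, c⟩, ⟨ha, hc, hac⟩, -⟩ := hC x
      simp only at ha hc hac
      exact ⟨a, ha, by rwa [← hac, add_sub_cancel_left]⟩) huniq
  have hper' : ∀ k c : ℤ, c ∈ C ↔ c + n * k ∈ C := by
    intro k
    induction k using Int.induction_on with
    | zero => simp
    | succ k ih =>
      intro c
      rw [ih c, hper, show c + n * k + n = c + n * (k + 1) by ring]
    | pred k ih =>
      intro c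
      rw [ih c, hper (c + n * (-k - 1)), show c + n * (-k - 1) + n = c + n * -k by ring]
  -- One period of C serves as the complement.
  refine ⟨n, {c ∈ Finset.Ico 0 (n : ℤ) | c ∈ C}, tilesMod_of_inj hn.ne' ?_ ?_⟩
  · intro x
    obtain ⟨⟨a, c⟩, ⟨ha, hc, hac⟩, -⟩ := hC x
    simp only at ha hc hac
    refine ⟨a, ha, c % n, ?_, ?_⟩
    · rw [Finset.mem_filter, Finset.mem_Ico]
      refine ⟨⟨Int.emod_nonneg _ (by omega), Int.emod_lt_of_pos _ (by omega)⟩, ?_⟩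
      rwa [hper' (c / n), Int.emod_add_mul_ediv]
    · rw [← hac]
      exact (Int.mod_modEq c n).add_left a
  · intro a ha a' ha' b hb b' hb' hab
    rw [Finset.mem_filter, Finset.mem_Ico] at hb hb'
    obtain ⟨k, hk⟩ := hab.dvd
    have h1 := huniq a ha a' ha' (b + n * k) ((hper' k b).1 hb.2) b' hb'.2
      (by linear_combination -hk)
    refine ⟨h1, ?_⟩
    have h2 : b ≡ b' [ZMOD n] := Int.modEq_iff_dvd.2 ⟨k, by linear_combination hk + h1⟩
    rwa [Int.ModEq, Int.emod_eq_of_lt hb.1.1 hb.1.2, Int.emod_eq_of_lt hb'.1.1 hb'.1.2] at h2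

theorem cyclotomic_dvd_maskPoly_iff {A : Finset ℕ} {s : ℕ} (hs : 0 < s) :
    cyclotomic s ℤ ∣ maskPoly A ↔ VanishesAt (intSet A) s := by
  rw [vanishesAt_iff_cyclotomic_dvd (f := maskPoly A) (k := 0) (fun z _ => ?_) hs]
  simp [maskPoly, charSum, intSet]

theorem mem_primePowerIndices_iff {A : Finset ℕ} {s : ℕ} :
    s ∈ primePowerIndices A ↔ IsPrimePow s ∧ VanishesAt (intSet A) s :=
  and_congr_right fun hs => cyclotomic_dvd_maskPoly_iff hs.pos

theorem T1_iff {A : Finset ℕ} (hA : A.Nonempty) :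
    T1 A ↔ ∏ s ∈ (finite_primePowerIndices hA).toFinset, s.minFac = A.card := by
  rw [T1, eval_one_maskPoly, finprod_mem_eq_finite_toFinset_prod _ (finite_primePowerIndices hA),
    Finset.prod_congr rfl fun s hs => eval_one_cyclotomic_of_isPrimePow
      ((Set.Finite.mem_toFinset _).1 hs).1, ← Nat.cast_prod, Nat.cast_inj, eq_comm]

/-! ### Sufficiency of (T1) and (T2) -/

/-- If ζ has order d, then ζ^t has order d / gcd(d, t) = s. The use is with t the part of N prime to
p and s the p-part of d. -/
theorem cyclotomic_dvd_expand {d s t : ℕ} (hd : 0 < d) (hgcd : d.gcd t * s = d) :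
    cyclotomic d ℤ ∣ expand ℤ t (cyclotomic s ℤ) := by
  have hz := Complex.isPrimitiveRoot_exp d hd.ne'
  have hg : 0 < d.gcd t := Nat.gcd_pos_of_pos_left _ hd
  have hs : 0 < s := Nat.pos_of_ne_zero (by rintro rfl; omega)
  rw [cyclotomic_dvd_iff_aeval_eq_zero hd hz, expand_aeval]
  have h1 := hz.pow hd hgcd.symm
  obtain ⟨u, hu⟩ := Nat.gcd_dvd_right d t
  have h2 : u.Coprime s := by
    have := Nat.coprime_div_gcd_div_gcd (m := d) (n := t) hg
    rw [Nat.div_eq_of_eq_mul_right hg hgcd.symm, Nat.div_eq_of_eq_mul_right hg hu] at this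
    exact this.symm
  have h3 := h1.pow_of_coprime u h2
  rw [← pow_mul, ← hu] at h3
  exact (cyclotomic_dvd_iff_aeval_eq_zero hs h3 _).1 dvd_rfl

/-- Φ_{p^(j+1)} is a sum of powers of x. Nonnegative coefficients are what later lets the complement
be read as a set. -/
theorem expand_cyclotomic_mem_rangeS {s : ℕ} (hs : IsPrimePow s) (t : ℕ) :
    expand ℤ t (cyclotomic s ℤ) ∈ (mapRingHom (Nat.castRingHom ℤ)).rangeS := by
  obtain ⟨p, k, hp, hk, rfl⟩ := (isPrimePow_nat_iff s).1 hs
  obtain ⟨j, rfl⟩ : ∃ j, k = j + 1 := ⟨k - 1, by omega⟩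
  have := Fact.mk hp
  refine ⟨∑ i ∈ Finset.range p, X ^ (t * (p ^ j * i)), ?_⟩
  rw [cyclotomic_prime_pow_eq_geom_sum hp]
  simp [pow_mul]

theorem gcd_ordCompl_of_dvd {d n p : ℕ} (hp : p.Prime) (hn : n ≠ 0) (hdn : d ∣ n) :
    d.gcd (ordCompl[p] n) = ordCompl[p] d := by
  refine Nat.dvd_antisymm ?_ (Nat.dvd_gcd (Nat.ordCompl_dvd d p)
    (Nat.ordCompl_dvd_ordCompl_of_dvd hdn p))
  have h1 : (d.gcd (ordCompl[p] n)).Coprime (p ^ d.factorization p) :=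
    ((Nat.coprime_ordCompl hp hn).pow_left _).symm.coprime_dvd_left (Nat.gcd_dvd_right _ _)
  refine h1.dvd_of_dvd_mul_left ?_
  rw [Nat.ordProj_mul_ordCompl_eq_self]
  exact Nat.gcd_dvd_left _ _

/-- A factor of the geometric sum complementing `A`, when `A` satisfies (T1) and (T2). -/
theorem exists_geom_sum_dvd_mul {A : Finset ℕ} (hA : A.Nonempty) (h1 : T1 A) (h2 : T2 A) :
    ∃ (N : ℕ) (g : ℕ[X]), 0 < N ∧ (maskPoly A).eval 1 * (g.map (Nat.castRingHom ℤ)).eval 1 = N ∧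
      ∑ i ∈ Finset.range N, (X : ℤ[X]) ^ i ∣ maskPoly A * g.map (Nat.castRingHom ℤ) := by
  classical
  set S := (finite_primePowerIndices hA).toFinset with hS
  have hmem : ∀ s, s ∈ S ↔ s ∈ primePowerIndices A := fun s => Set.Finite.mem_toFinset _
  -- Any nonzero common multiple of S_A would do.
  set N := ∏ s ∈ S, s with hN
  have hN0 : N ≠ 0 := Finset.prod_ne_zero_iff.2 fun s hs => ((hmem s).1 hs).1.ne_zero
  have hSN : S ⊆ primePowDivisors N := fun s hs =>
    (mem_primePowDivisors hN0).2 ⟨Finset.dvd_prod_of_mem _ hs, ((hmem s).1 hs).1⟩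
  set f : ℤ[X] := ∏ s ∈ primePowDivisors N \ S,
    expand ℤ (ordCompl[s.minFac] N) (cyclotomic s ℤ) with hf
  have hpp : ∀ s ∈ primePowDivisors N \ S, IsPrimePow s := fun s hs =>
    ((mem_primePowDivisors hN0).1 (Finset.mem_sdiff.1 hs).1).2
  obtain ⟨g, hg⟩ : f ∈ (mapRingHom (Nat.castRingHom ℤ)).rangeS :=
    Subsemiring.prod_mem _ fun s hs => expand_cyclotomic_mem_rangeS (hpp s hs) _
  rw [coe_mapRingHom] at hg
  refine ⟨N, g, Nat.pos_of_ne_zero hN0, ?_, ?_⟩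
  · have hf1 : f.eval 1 = ((∏ s ∈ primePowDivisors N \ S, s.minFac : ℕ) : ℤ) := by
      rw [hf, eval_prod, Nat.cast_prod]
      refine Finset.prod_congr rfl fun s hs => ?_
      rw [expand_eval, one_pow, eval_one_cyclotomic_of_isPrimePow (hpp s hs)]
    rw [hg, hf1, eval_one_maskPoly, ← (T1_iff hA).1 h1, ← Nat.cast_mul, mul_comm,
      Finset.prod_sdiff hSN, prod_minFac_primePowDivisors hN0]
  · rw [hg, ← prod_cyclotomic_eq_geom_sum (Nat.pos_of_ne_zero hN0)]
    refine prod_cyclotomic_dvd (fun d hd => ?_) fun d hd => ?_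
    · exact Nat.pos_of_mem_divisors (Finset.mem_erase.1 hd).2
    · rw [Finset.mem_erase, Nat.mem_divisors] at hd
      obtain ⟨hd1, hdN, -⟩ := hd
      have hd0 : d ≠ 0 := fun h0 => hN0 (Nat.eq_zero_of_zero_dvd (h0 ▸ hdN))
      -- If all prime-power components of d lie in S_A, (T2) gives Φ_d ∣ A(x); otherwise a missing
      -- component p^e supplies a factor of the complement divisible by Φ_d.
      by_cases hall : ∀ p ∈ d.primeFactors, p ^ d.factorization p ∈ primePowerIndices A
      · refine dvd_mul_of_dvd_left ?_ _
        have := h2 d.primeFactors d.factorization (Nat.nonempty_primeFactors.2 (by omega))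
          (fun p hp => Nat.prime_of_mem_primeFactors hp) hall
        rwa [show ∏ p ∈ d.primeFactors, p ^ d.factorization p = d from
          Nat.prod_factorization_pow_eq_self hd0] at this
      · push Not at hall
        obtain ⟨p, hp, hnot⟩ := hall
        have hpp := Nat.prime_of_mem_primeFactors hp
        have he : d.factorization p ≠ 0 :=
          (hpp.factorization_pos_of_dvd hd0 (Nat.dvd_of_mem_primeFactors hp)).ne'
        have hs : p ^ d.factorization p ∈ primePowDivisors N \ S :=
          Finset.mem_sdiff.2 ⟨(mem_primePowDivisors hN0).2
            ⟨(Nat.ordProj_dvd d p).trans hdN, hpp.isPrimePow.pow he⟩, fun h => hnot ((hmem _).1 h)⟩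
        have hfac := Finset.dvd_prod_of_mem
          (fun s => expand ℤ (ordCompl[s.minFac] N) (cyclotomic s ℤ)) hs
        have hdvd : cyclotomic d ℤ ∣
            expand ℤ (ordCompl[p] N) (cyclotomic (p ^ d.factorization p) ℤ) :=
          cyclotomic_dvd_expand (Nat.pos_of_ne_zero hd0) (by
            rw [gcd_ordCompl_of_dvd hpp hN0 hdN, mul_comm, Nat.ordProj_mul_ordCompl_eq_self])
        simp only [hpp.pow_minFac he] at hfac
        exact dvd_mul_of_dvd_right (hdvd.trans hfac) _

theorem tilesIntegers_of_T1_T2 {A : Finset ℕ} (hA : A.Nonempty) (h1 : T1 A) (h2 : T2 A) :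
    TilesIntegers A := by
  classical
  obtain ⟨N, g, hN, heval, Q, hQ⟩ := exists_geom_sum_dvd_mul hA h1 h2
  have : NeZero N := ⟨hN.ne'⟩
  have hQ1 : Q.eval 1 = 1 := by
    have h3 := congrArg (eval (1 : ℤ)) hQ
    rw [eval_mul, eval_mul, heval, eval_geom_sum] at h3
    simp only [one_pow, Finset.sum_const, Finset.card_range, nsmul_eq_mul, mul_one] at h3
    exact (mul_left_cancel₀ (by exact_mod_cast hN.ne') (h3.symm.trans (mul_one _).symm))
  let e : ZMod N → AddMonoidAlgebra ℤ (ZMod N) := fun y => AddMonoidAlgebra.single y 1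
  have he : ∀ y y', e (y + y') = e y * e y' := fun y y' => by
    simp [e, AddMonoidAlgebra.single_mul_single]
  have hepow : ∀ k : ℕ, e 1 ^ k = e k := by
    intro k
    induction k with
    | zero => simp [e, AddMonoidAlgebra.one_def]
    | succ k ih => rw [pow_succ, ih, ← he, Nat.cast_succ]
  set M := ∑ y, e y with hM
  have heM : e 1 * M = M := by
    rw [hM, Finset.mul_sum]
    simp only [← he]
    exact Fintype.sum_equiv (Equiv.addLeft 1) _ _ fun _ => rfl
  have hgeom : aeval (e 1) (∑ i ∈ Finset.range N, (X : ℤ[X]) ^ i) = M := by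
    rw [map_sum, hM]
    simp only [map_pow, aeval_X, hepow]
    symm
    refine Finset.sum_bij (fun y _ => y.val) (by simp [ZMod.val_lt]) ?_ ?_ (by simp)
    · intro x _ y _ hxy
      exact ZMod.val_injective N hxy
    · intro i hi
      exact ⟨(i : ZMod N), by simp, ZMod.val_cast_of_lt (Finset.mem_range.1 hi)⟩
  -- Multiplying the sum M of all group elements by P only sees P(1), so the unknown cofactor Q,
  -- with Q(1) = 1, disappears in the group ring.
  have hMQ : ∀ P : ℤ[X], M * aeval (e 1) P = P.eval 1 • M := by
    intro P
    induction P using Polynomial.induction_on' with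
    | add P P' hP hP' => rw [map_add, mul_add, hP, hP', eval_add, add_smul]
    | monomial k c =>
      have hk : M * e 1 ^ k = M := by
        induction k with
        | zero => simp
        | succ k ih => rw [pow_succ, ← mul_assoc, ih, mul_comm, heM]
      rw [aeval_monomial, eval_monomial, one_pow, mul_one, mul_left_comm, hk,
        ← Algebra.smul_def]
  have hkey := congrArg (aeval (e 1)) hQ
  rw [map_mul, map_mul, hgeom, hMQ, hQ1, one_smul] at hkey
  obtain ⟨γ, hγ⟩ : ∃ γ : ZMod N → ℕ,
      aeval (e 1) (g.map (Nat.castRingHom ℤ)) = ∑ y, γ y • e y := by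
    clear hQ heval hkey
    induction g using Polynomial.induction_on' with
    | add g g' hg hg' =>
      obtain ⟨γ, hγ⟩ := hg
      obtain ⟨γ', hγ'⟩ := hg'
      exact ⟨γ + γ', by
        simp only [Polynomial.map_add, map_add, hγ, hγ', Pi.add_apply, add_smul,
          Finset.sum_add_distrib]⟩
    | monomial k c =>
      refine ⟨Pi.single (k : ZMod N) c, ?_⟩
      rw [Finset.sum_eq_single (k : ZMod N) (fun y _ hy => by simp [hy]) (by simp),
        Pi.single_eq_same, map_monomial, aeval_monomial, hepow]
      simp
  have hmask : aeval (e 1) (maskPoly A) = ∑ a ∈ A, e a := by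
    simp [maskPoly, hepow]
  -- Natural numbers summing to 1: exactly one term is nonzero, which is existence and uniqueness of
  -- the representation.
  have hcount : ∀ x : ZMod N, ∑ a ∈ A, γ (x - a) = 1 := by
    intro x
    have h3 := congrArg (fun F => F.coeff x) hkey
    have hsm : ∀ (k : ℕ) (y : ZMod N), (k • e y).coeff x = if y = x then (k : ℤ) else 0 := by
      intro k y
      simp [e, Finsupp.single_apply]
    have hone : M.coeff x = 1 := by
      simp [hM, e, Finsupp.single_apply]
    rw [hmask, hγ, Finset.sum_mul_sum] at h3
    simp only [mul_smul_comm, ← he, AddMonoidAlgebra.coeff_sum, Finsupp.finsetSum_apply, hsm,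
      hone, ← eq_sub_iff_add_eq', Finset.sum_ite_eq', Finset.mem_univ, if_true] at h3
    exact_mod_cast h3
  refine ⟨{c : ℤ | γ c ≠ 0}, fun n => ?_⟩
  obtain ⟨a, ha, hne⟩ : ∃ a ∈ A, γ ((n : ZMod N) - a) ≠ 0 :=
    Finset.exists_ne_zero_of_sum_ne_zero (by rw [hcount]; exact one_ne_zero)
  refine ⟨((a : ℤ), n - a), ⟨⟨a, ha, rfl⟩, by simpa using hne, by simp⟩, ?_⟩
  rintro ⟨x, c⟩ ⟨⟨b, hb, hbx⟩, hc, hxc⟩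
  simp only at hbx hc hxc
  subst hbx
  have hc' : c = n - b := by omega
  subst hc'
  have hab : b = a := by
    by_contra hab
    have h3 : ∑ i ∈ ({b, a} : Finset ℕ), γ ((n : ZMod N) - i) ≤ 1 := by
      rw [← hcount n]
      refine Finset.sum_le_sum_of_subset ?_
      rintro i hi
      rcases Finset.mem_insert.1 hi with rfl | hi
      · exact hb
      · rwa [Finset.mem_singleton.1 hi]
    rw [Finset.sum_pair hab] at h3
    have h4 : γ ((n : ZMod N) - b) ≠ 0 := by simpa using hc
    omega
  rw [hab]

/-! ### Necessity and the conclusion -/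

theorem T1_T2_of_tilesIntegers {A : Finset ℕ} (hA : A.Nonempty)
    (hcard : A.card.primeFactors.card ≤ 2) (h : TilesIntegers A) : T1 A ∧ T2 A := by
  have hcA : (intSet A).card = A.card := Finset.card_map _
  obtain ⟨n, B, hB⟩ := h.exists_tilesMod hA
  constructor
  · rw [T1_iff hA, ← hcA]
    exact hB.prod_minFac_eq_card fun s => by
      rw [Set.Finite.mem_toFinset, mem_primePowerIndices_iff]
  · intro P e hP hPp hPe
    -- Each prime in P divides A(1) = #A because Φ_{p^e}(1) = p; hence P has at most two elements.
    have hPA : P ⊆ A.card.primeFactors := by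
      intro p hp
      have h1 := eval_one_maskPoly A ▸ prod_minFac_dvd_eval_one (S := {p ^ e p})
        (f := maskPoly A) (by simpa using (hPe p hp).1) (by simpa using (hPe p hp).2)
      have he : e p ≠ 0 := fun h0 => (hPe p hp).1.ne_one (by rw [h0, pow_zero])
      rw [Finset.prod_singleton, (hPp p hp).pow_minFac he, Int.natCast_dvd_natCast] at h1
      exact Nat.mem_primeFactors.2 ⟨hPp p hp, h1, hA.card_ne_zero⟩
    have hP2 := (Finset.card_le_card hPA).trans hcard
    rcases (show P.card = 1 ∨ P.card = 2 by have := hP.card_pos; omega) with h1 | h1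
    · obtain ⟨p, rfl⟩ := Finset.card_eq_one.1 h1
      rw [Finset.prod_singleton]
      exact (hPe p (Finset.mem_singleton_self p)).2
    · obtain ⟨p, q, hpq, rfl⟩ := Finset.card_eq_two.1 h1
      have hPeq := Finset.eq_of_subset_of_card_le hPA (hcard.trans h1.ge)
      have hp := hPp p (by simp)
      have hq := hPp q (by simp)
      -- The original period may have further prime factors; the new one has none besides p and q.
      obtain ⟨m, B', hB', hm⟩ := hB.exists_dvd_card
      have hmain := hB'.vanishesAtProducts hp hq hpq fun l hl hlm => by
        have h2 : l ∈ A.card.primeFactors :=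
          Nat.mem_primeFactors.2 ⟨hl, hcA ▸ hm l hl hlm, hA.card_ne_zero⟩
        simpa [← hPeq] using h2
      obtain ⟨hps, hpv⟩ := mem_primePowerIndices_iff.1 (hPe p (by simp))
      obtain ⟨hqs, hqv⟩ := mem_primePowerIndices_iff.1 (hPe q (by simp))
      have he : ∀ r, IsPrimePow (r ^ e r) → 0 < e r := fun r hr =>
        Nat.pos_of_ne_zero fun h0 => hr.ne_one (by rw [h0, pow_zero])
      rw [Finset.prod_pair hpq, cyclotomic_dvd_maskPoly_iff (Nat.mul_pos hps.pos hqs.pos)]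
      exact hmain _ _ (he p hps) (he q hqs) hpv hqv

end CovenMeyerowitz

theorem mainTheorem2 (A : Finset ℕ) (hA : A.Nonempty)
    (hcard : A.card.primeFactors.card ≤ 2) :
    CovenMeyerowitz.TilesIntegers A ↔ CovenMeyerowitz.T1 A ∧ CovenMeyerowitz.T2 A :=
  ⟨CovenMeyerowitz.T1_T2_of_tilesIntegers hA hcard,
    fun h => CovenMeyerowitz.tilesIntegers_of_T1_T2 hA h.1 h.2⟩
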